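/- Let $X$ be an infinite set. For $n\ge 1$ let $\mathscr O^{(n)}$ be the set of all functions $X^n\to X$, and let $\mathscr O=\bigcup_{n\ge1}\mathscr O^{(n)}$. A clone on $X$ is a subset of $\mathscr O$ that contains all projections $(x_1,\dots,x_n)\mapsto x_k$ ($1\le k\le n$) and is closed under composition of functions. A clone $\mathscr C$ is precomplete (maximal) if it is a dual atom of the lattice of all clones on $X$ ordered by inclusion, i.e. $\mathscr C\neq\mathscr O$ and the only clone properly containing $\mathscr C$ is $\mathscr O$. A clone $\mathscr C$ is symmetric if it is closed under conjugation by permutations of $X$, i.e. $\mathscr C=\{\gamma^{-1}(f(\gamma(x_1),\dots,\gamma(x_n))) : f\in\mathscr C,\ \gamma\in\mathrm{Sym}(X)\}$, where $n$ is the arity of $f$. Theorem. If $\mathscr C$ is a symmetric precomplete clone on $X$, then $\mathscr C$ contains every permutation of $X$ (as a unary operation). -/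

import Mathlib

/-- The `n`-ary operations on `X`. -/
abbrev Operation (X : Type*) (n : ℕ) : Type _ := (Fin n → X) → X

/-- A clone on `X`: a set of finitary operations of arities `n ≥ 1`, given by its `n`-ary parts
`ops n`, which contains all projections and is closed under composition of functions. -/
@[ext]
structure FunctionClone (X : Type*) where
  /-- The operations of arity `n` that belong to the clone. -/
  ops : ∀ n : ℕ+, Set (Operation X n)
  /-- The projections `(x₁, …, xₙ) ↦ xₖ` belong to the clone. -/
  proj_mem : ∀ (n : ℕ+) (k : Fin n), (fun x : Fin n → X => x k) ∈ ops n
  /-- If `f` is `m`-ary and `g₁, …, gₘ` are `n`-ary operations of the clone, then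
  `f(g₁, …, gₘ)` belongs to the clone. -/
  comp_mem : ∀ {m n : ℕ+} (f : Operation X m) (g : Fin m → Operation X n),
    f ∈ ops m → (∀ i, g i ∈ ops n) → (fun x : Fin n → X => f (fun i => g i x)) ∈ ops n

namespace FunctionClone

/-- Clones are ordered by inclusion. -/
instance (X : Type*) : PartialOrder (FunctionClone X) :=
  PartialOrder.lift FunctionClone.ops (fun _ _ h => FunctionClone.ext h)

/-- The greatest clone consists of all operations of positive finite arity. -/
instance (X : Type*) : OrderTop (FunctionClone X) where
  top :=
    { ops := fun _ => Set.univ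
      proj_mem := fun _ _ => Set.mem_univ _
      comp_mem := fun _ _ _ _ => Set.mem_univ _ }
  le_top := fun _ _ => Set.subset_univ _

/-- A clone is precomplete (maximal) iff it is a dual atom of the lattice of all clones. -/
def IsPrecomplete {X : Type*} (C : FunctionClone X) : Prop := IsCoatom C

/-- The conjugate `(x₁, …, xₙ) ↦ γ⁻¹ (f (γ x₁, …, γ xₙ))` of the operation `f` by the
permutation `γ`. -/
def conj {X : Type*} {n : ℕ} (γ : Equiv.Perm X) (f : Operation X n) : Operation X n :=
  fun x => γ.symm (f (fun i => γ (x i)))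

/-- A clone is symmetric iff it is closed under conjugation, that is, it equals the set of all
conjugates of its members by permutations. -/
def IsSymmetric {X : Type*} (C : FunctionClone X) : Prop :=
  ∀ n : ℕ+, C.ops n = {h | ∃ γ : Equiv.Perm X, ∃ f ∈ C.ops n, h = conj γ f}

/-- A clone contains all permutations iff every permutation of `X`, regarded as a unary operation,
belongs to it. -/
def ContainsPerms {X : Type*} (C : FunctionClone X) : Prop :=
  ∀ σ : Equiv.Perm X, (fun x : Fin 1 → X => σ (x 0)) ∈ C.ops 1

end FunctionClone

/-!
Let `C` be a symmetric precomplete clone and suppose that some permutation lies outside `C`. If a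
relation `R ⊆ X ^ I` is invariant under `C` and under one permutation `α ∉ C`, then the clone of
all operations preserving `R` lies strictly above `C`, hence is the clone of all operations
(`preserves_of_invariant`). Symmetry supplies such relations, because the conjugate `α ∘ f ∘ α⁻¹`
of a unary `f ∈ C` lies in `C` and `α ∘ f = (α ∘ f ∘ α⁻¹) ∘ α`; likewise for other arities. Call a
set a moiety if it and its complement have the size of `X`.

* A permutation outside `C` factors into two permutations each fixing a moiety pointwise, so,
  after conjugation, for every moiety `A` there is some `α ∉ C` that is the identity on `A`
  (`exists_perm_notMem_fixing`). The relation formed by the restrictions to `A ^ n` of the `n`-ary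
  members of `C` is then `α`-invariant, so every operation agrees on `A ^ n` with a member of `C`
  (`exists_mem_ops_eqOn`).
* If a unary `m ∈ C` satisfies `m ∘ α = m` for some `α ∉ C`, then the relation of all `m` with
  `m ∘ β ∈ C` for each power `β` of `α` shows that `g ∘ m ∈ C` for every `g : X → X`
  (`comp_mem_unary_of_comp_perm_eq`).

Prescribing `m` on a moiety that contains the support of `α` yields unary members of `C` that map
all of `X` into a fixed moiety `A` and are injective on any given moiety
(`exists_mem_unary_injOn`). Three of them are jointly injective, and composing them with a ternary
member of `C` prescribed on `A ^ 3` gives every function `X → X`, a contradiction.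
-/

open Cardinal

namespace FunctionClone

variable {X : Type*}

/-! ### Invariant relations -/

/-- The unary part of a clone, as a set of functions `X → X`. -/
def unary (C : FunctionClone X) : Set (X → X) :=
  {g | (fun x : Fin 1 → X => g (x 0)) ∈ C.ops 1}

/-- The relation `R`, a set of `I`-indexed tuples, is preserved by the operation `f`. -/
def Preserves {I : Type*} {n : ℕ} (f : Operation X n) (R : Set (I → X)) : Prop :=
  ∀ r : Fin n → I → X, (∀ i, r i ∈ R) → (fun t => f (fun i => r i t)) ∈ R

/-- The clone of all operations that preserve the relation `R`. -/
def polymorphisms {I : Type*} (R : Set (I → X)) : FunctionClone X where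
  ops _ := {f | Preserves f R}
  proj_mem _ k _ hr := hr k
  comp_mem _ _ hf hg r hr := hf _ fun i => hg i r hr

theorem id_mem_unary (C : FunctionClone X) : id ∈ C.unary := C.proj_mem 1 0

theorem comp_unary_mem_unary {C : FunctionClone X} {n : ℕ+} {f : Operation X n}
    {g : Fin n → X → X} (hf : f ∈ C.ops n) (hg : ∀ i, g i ∈ C.unary) :
    (fun x => f (fun i => g i x)) ∈ C.unary :=
  C.comp_mem (n := 1) f (fun i x => g i (x 0)) hf hg

theorem IsSymmetric.conj_mem {C : FunctionClone X} (hsymm : C.IsSymmetric) {n : ℕ+}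
    (γ : Equiv.Perm X) {f : Operation X n} (hf : f ∈ C.ops n) : conj γ f ∈ C.ops n := by
  rw [hsymm n]
  exact ⟨γ, f, hf, rfl⟩

theorem IsSymmetric.conj_mem_unary {C : FunctionClone X} (hsymm : C.IsSymmetric)
    (γ : Equiv.Perm X) {g : X → X} (hg : g ∈ C.unary) :
    (fun x => γ.symm (g (γ x))) ∈ C.unary :=
  hsymm.conj_mem γ hg

/-- A relation invariant under a precomplete clone `C` and under one unary operation outside `C` is
invariant under all operations. -/
theorem preserves_of_invariant {C : FunctionClone X} (hpre : C.IsPrecomplete) {α : X → X}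
    (hα : α ∉ C.unary) {I : Type*} {R : Set (I → X)}
    (hR : ∀ (n : ℕ+) (f : Operation X n), f ∈ C.ops n → Preserves f R)
    (hαR : ∀ r ∈ R, (fun t => α (r t)) ∈ R) {n : ℕ+} (f : Operation X n) : Preserves f R := by
  have hle : C ≤ polymorphisms R := hR
  have hmem : α ∈ (polymorphisms R).unary := fun r hr => hαR _ (hr 0)
  have hlt : C < polymorphisms R := lt_of_le_of_ne hle fun h => hα (h ▸ hmem)
  have htop : polymorphisms R = ⊤ := hpre.2 _ hlt
  have : f ∈ (polymorphisms R).ops n := by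
    rw [htop]
    exact Set.mem_univ f
  exact this

/-- If the fixed points of some permutation outside `C` include `A`, then every operation agrees
on tuples from `A` with a member of `C`. -/
theorem exists_mem_ops_eqOn {C : FunctionClone X} (hsymm : C.IsSymmetric)
    (hpre : C.IsPrecomplete) {α : Equiv.Perm X} (hα : ⇑α ∉ C.unary) {A : Set X}
    (hA : ∀ x ∈ A, α x = x) {n : ℕ+} (h : Operation X n) :
    ∃ f ∈ C.ops n, ∀ x : Fin n → X, (∀ i, x i ∈ A) → f x = h x := by
  let R : Set ((Fin n → A) → X) := {r | ∃ f ∈ C.ops n, ∀ t, r t = f (fun i => t i)}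
  have key : Preserves h R := by
    refine preserves_of_invariant hpre hα ?_ ?_ h
    · intro m f hf r hr
      choose g hg hgr using hr
      exact ⟨_, C.comp_mem f g hf hg, fun t => by simp only [hgr]⟩
    · rintro r ⟨f, hf, hfr⟩
      refine ⟨conj α.symm f, hsymm.conj_mem _ hf, fun t => ?_⟩
      have ht : (fun i => α.symm (t i : X)) = fun i => (t i : X) := by
        funext i
        rw [Equiv.symm_apply_eq, hA _ (t i).2]
      simp only [conj, hfr, ht, Equiv.symm_symm]
  obtain ⟨f, hf, hfh⟩ := key (fun i t => t i) fun i => ⟨_, C.proj_mem n i, fun _ => rfl⟩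
  exact ⟨f, hf, fun x hx => (hfh fun i => ⟨x i, hx i⟩).symm⟩

/-- A unary member `m` of `C` that is unchanged by precomposition with some permutation outside
`C` generates a left ideal of functions inside `C`. -/
theorem comp_mem_unary_of_comp_perm_eq {C : FunctionClone X} (hsymm : C.IsSymmetric)
    (hpre : C.IsPrecomplete) {α : Equiv.Perm X} (hα : ⇑α ∉ C.unary) {m : X → X}
    (hm : m ∈ C.unary) (hmα : ∀ x, m (α x) = m x) (g : X → X) :
    (fun x => g (m x)) ∈ C.unary := by
  let R : Set (X → X) := {r | ∀ k : ℕ, (fun x => r ((α ^ k) x)) ∈ C.unary}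
  have key : Preserves (fun x : Fin (1 : ℕ+) → X => g (x 0)) R := by
    refine preserves_of_invariant hpre hα ?_ ?_ _
    · intro n f hf r hr k
      exact comp_unary_mem_unary hf fun i => hr i k
    · intro r hr k
      -- `α ∘ r ∘ α ^ k` is the conjugate of `r ∘ α ^ (k + 1)` by `α⁻¹`.
      have := hsymm.conj_mem_unary α.symm (hr (k + 1))
      simpa [pow_succ] using this
  have hmR : m ∈ R := by
    intro k
    have : (fun x => m ((α ^ k) x)) = m := by
      induction k with
      | zero => simp
      | succ k ih =>
        funext x
        rw [pow_succ, Equiv.Perm.mul_apply, congrFun ih (α x), hmα]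
    rwa [this]
  simpa using key (fun _ => m) (fun _ => hmR) 0

/-! ### Permutations fixing a moiety -/

/-- A moiety of `X`: a subset such that it and its complement both have the size of `X`. -/
def IsMoiety (A : Set X) : Prop := #A = #X ∧ #(Aᶜ : Set X) = #X

theorem mk_eq_of_subset {A B : Set X} (h : A ⊆ B) (hA : #A = #X) : #B = #X :=
  le_antisymm (mk_set_le B) (hA ▸ mk_le_mk_of_subset h)

theorem isMoiety_of_disjoint {A B : Set X} (h : Disjoint A B) (hA : #A = #X) (hB : #B = #X) :
    IsMoiety A :=
  ⟨hA, mk_eq_of_subset h.subset_compl_left hB⟩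

theorem exists_disjoint_subsets [Infinite X] {S : Set X} (hS : #S = #X) :
    ∃ A B : Set X, A ⊆ S ∧ B ⊆ S ∧ Disjoint A B ∧ #A = #X ∧ #B = #X := by
  have hadd : #(X ⊕ X) = #S := by
    rw [hS, ← add_def, add_eq_self (aleph0_le_mk X)]
  obtain ⟨e⟩ := Cardinal.eq.1 hadd
  have hi : Function.Injective fun x : X => (e (Sum.inl x) : X) := fun x y h => by
    simpa using e.injective (Subtype.ext h)
  have hj : Function.Injective fun x : X => (e (Sum.inr x) : X) := fun x y h => by
    simpa using e.injective (Subtype.ext h)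
  refine ⟨_, _, ?_, ?_, ?_, mk_range_eq _ hi, mk_range_eq _ hj⟩
  · rintro _ ⟨x, rfl⟩
    exact (e _).2
  · rintro _ ⟨x, rfl⟩
    exact (e _).2
  · rw [Set.disjoint_left]
    rintro _ ⟨x, rfl⟩ ⟨y, hy⟩
    simpa using e.injective (Subtype.ext hy)

theorem exists_perm_mapsTo {A B : Set X} (hA : IsMoiety A) (hB : IsMoiety B) :
    ∃ γ : Equiv.Perm X, ∀ x ∈ A, γ x ∈ B := by
  classical
  obtain ⟨e⟩ := Cardinal.eq.1 (hA.1.trans hB.1.symm)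
  obtain ⟨e'⟩ := Cardinal.eq.1 (hA.2.trans hB.2.symm)
  refine ⟨(Equiv.Set.sumCompl A).symm.trans ((e.sumCongr e').trans (Equiv.Set.sumCompl B)), ?_⟩
  intro x hx
  simp [Equiv.Set.sumCompl_symm_apply_of_mem hx]

/-- Every permutation `σ` either has as many fixed points as `X` has elements, or moves some set
of that size to a disjoint set. -/
theorem exists_disjoint_image_or_fixed [Infinite X] (σ : Equiv.Perm X) :
    (∃ A : Set X, #A = #X ∧ ∀ x ∈ A, σ x ∉ A) ∨ #{x | σ x = x} = #X := by
  obtain ⟨A, hA⟩ := zorn_subset {A : Set X | ∀ x ∈ A, σ x ∉ A} fun c hc hch => by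
    refine ⟨⋃₀ c, ?_, fun s hs => Set.subset_sUnion_of_mem hs⟩
    rintro x ⟨s, hs, hxs⟩ ⟨t, ht, hxt⟩
    rcases hch.total hs ht with h | h
    · exact hc ht x (h hxs) hxt
    · exact hc hs x hxs (h hxt)
  -- Maximality of `A` means that nothing outside the following four sets can be added to `A`.
  have hcover : (Set.univ : Set X) ⊆ (A ∪ σ '' A) ∪ (σ.symm '' A ∪ {x | σ x = x}) := by
    intro x _
    by_contra hx
    simp only [Set.mem_union, Set.mem_image, Set.mem_ofPred_eq, not_or, not_exists, not_and] at hx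
    obtain ⟨⟨hxA, hx1⟩, hx2, hx3⟩ := hx
    refine hxA (hA.2 (y := insert x A) ?_ (Set.subset_insert x A) (Set.mem_insert x A))
    rintro y (rfl | hy) (h | h)
    · exact hx3 h
    · exact hx2 _ h (σ.symm_apply_apply y)
    · exact hx1 y hy h
    · exact hA.1 y hy h
  by_contra hcon
  rw [not_or, not_exists] at hcon
  have hAlt : #A < #X := lt_of_le_of_ne (mk_set_le A) fun h => hcon.1 A ⟨h, hA.1⟩
  have hFlt : #{x | σ x = x} < #X := lt_of_le_of_ne (mk_set_le _) hcon.2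
  have hinf := aleph0_le_mk X
  have hlt := add_lt_of_lt hinf (add_lt_of_lt hinf hAlt ((mk_image_le (f := σ)).trans_lt hAlt))
    (add_lt_of_lt hinf ((mk_image_le (f := σ.symm)).trans_lt hAlt) hFlt)
  have hle := (mk_le_mk_of_subset hcover).trans
    ((mk_union_le _ _).trans (add_le_add (mk_union_le _ _) (mk_union_le _ _)))
  rw [mk_univ] at hle
  exact absurd hlt (not_lt.2 hle)

/-- Every permutation is a product of two permutations that each fix some moiety pointwise. -/
theorem exists_eq_mul_fixing_moiety [Infinite X] (σ : Equiv.Perm X) :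
    ∃ τ ρ : Equiv.Perm X, σ = τ * ρ ∧ (∃ A, IsMoiety A ∧ ∀ x ∈ A, τ x = x) ∧
      ∃ A, IsMoiety A ∧ ∀ x ∈ A, ρ x = x := by
  classical
  rcases exists_disjoint_image_or_fixed σ with ⟨S, hS, hσ⟩ | hF
  · obtain ⟨A, B, hAS, hBS, hAB, hA, hB⟩ := exists_disjoint_subsets hS
    -- `τ` interchanges `A` and `σ '' A` through `σ`, so it fixes `B`, and `τ * σ` fixes `A`.
    let t : X → X := fun x => if x ∈ A then σ x else if σ.symm x ∈ A then σ.symm x else x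
    have ht : Function.Involutive t := by
      intro x
      by_cases h1 : x ∈ A
      · have h2 : σ x ∉ A := fun h => hσ x (hAS h1) (hAS h)
        simp [t, h1, h2]
      · by_cases h2 : σ.symm x ∈ A
        · simp [t, h1, h2]
        · simp [t, h1, h2]
    refine ⟨ht.toPerm, ht.toPerm * σ, ?_, ⟨B, isMoiety_of_disjoint hAB.symm hB hA, ?_⟩,
      A, isMoiety_of_disjoint hAB hA hB, ?_⟩
    · ext x
      simp [ht (σ x)]
    · intro x hx
      have h1 : x ∉ A := fun h => Set.disjoint_left.1 hAB h hx
      have h2 : σ.symm x ∉ A := fun h => hσ _ (hAS h) (by simpa using hBS hx)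
      simp [t, h1, h2]
    · intro x hx
      have h2 : σ x ∉ A := fun h => hσ x (hAS hx) (hAS h)
      simp [t, hx, h2]
  · obtain ⟨A, B, hAF, -, hAB, hA, hB⟩ := exists_disjoint_subsets hF
    have hm := isMoiety_of_disjoint hAB hA hB
    exact ⟨1, σ, by simp, ⟨A, hm, fun _ _ => rfl⟩, A, hm, fun x hx => hAF hx⟩

theorem exists_perm_notMem_fixing [Infinite X] {C : FunctionClone X} (hsymm : C.IsSymmetric)
    {σ : Equiv.Perm X} (hσ : ⇑σ ∉ C.unary) {A : Set X} (hA : IsMoiety A) :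
    ∃ α : Equiv.Perm X, ⇑α ∉ C.unary ∧ ∀ x ∈ A, α x = x := by
  obtain ⟨β, hβ, B, hB, hfix⟩ : ∃ β : Equiv.Perm X, ⇑β ∉ C.unary ∧
      ∃ B, IsMoiety B ∧ ∀ x ∈ B, β x = x := by
    obtain ⟨τ, ρ, rfl, hτ, hρ⟩ := exists_eq_mul_fixing_moiety σ
    by_cases h : ⇑τ ∈ C.unary
    · exact ⟨ρ, fun h' => hσ (comp_unary_mem_unary h fun _ => h'), hρ⟩
    · exact ⟨τ, h, hτ⟩
  obtain ⟨γ, hγ⟩ := exists_perm_mapsTo hA hB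
  refine ⟨(γ.trans β).trans γ.symm, fun h => hβ ?_, fun x hx => ?_⟩
  · simpa using hsymm.conj_mem_unary γ.symm h
  · simp [hfix _ (hγ x hx)]

/-! ### Unary members with small range -/

theorem exists_mem_unary_injOn [Infinite X] {C : FunctionClone X} (hsymm : C.IsSymmetric)
    (hpre : C.IsPrecomplete) {σ : Equiv.Perm X} (hσ : ⇑σ ∉ C.unary) {A D : Set X}
    (hA : #A = #X) (hD : #(Dᶜ : Set X) = #X) :
    ∃ p ∈ C.unary, (∀ x, p x ∈ A) ∧ Set.InjOn p D := by
  classical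
  obtain ⟨E, F, hED, hFD, hEF, hE, hF⟩ := exists_disjoint_subsets hD
  -- `α` moves only points of `E`, and members of `C` can be prescribed outside `F`.
  obtain ⟨α, hα, hαfix⟩ := exists_perm_notMem_fixing hsymm hσ (A := Eᶜ)
    ⟨mk_eq_of_subset hEF.subset_compl_left hF, by rwa [compl_compl]⟩
  obtain ⟨β, hβ, hβfix⟩ := exists_perm_notMem_fixing hsymm hσ (A := Fᶜ)
    ⟨mk_eq_of_subset hEF.subset_compl_right hE, by rwa [compl_compl]⟩
  have hαE : ∀ x ∈ E, α x ∈ E := fun x hx => by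
    by_contra h
    exact h (by rwa [α.injective (hαfix _ h)])
  let x₀ : X := Classical.arbitrary X
  obtain ⟨f, hf, hfh⟩ := exists_mem_ops_eqOn hsymm hpre hβ hβfix (n := 1)
    fun x => if x 0 ∈ D then x 0 else x₀
  let m : X → X := fun x => f fun _ => x
  have hm : m ∈ C.unary := comp_unary_mem_unary hf fun _ => C.id_mem_unary
  have hmF : ∀ x ∉ F, m x = if x ∈ D then x else x₀ := fun x hx => hfh (fun _ => x) fun _ => hx
  have hmα : ∀ x, m (α x) = m x := fun x => by
    by_cases hx : x ∈ E
    · have hx' := hαE x hx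
      rw [hmF _ (Set.disjoint_left.1 hEF hx), hmF _ (Set.disjoint_left.1 hEF hx'),
        if_neg (hED hx), if_neg (hED hx')]
    · rw [hαfix x hx]
  obtain ⟨e⟩ := Cardinal.eq.1 hA
  refine ⟨fun x => e.symm (m x), comp_mem_unary_of_comp_perm_eq hsymm hpre hα hm hmα
    fun x => e.symm x, fun x => (e.symm _).2, fun x hx y hy hxy => ?_⟩
  have hxy' : m x = m y := e.symm.injective (Subtype.ext hxy)
  rwa [hmF x fun h => hFD h hx, hmF y fun h => hFD h hy, if_pos hx, if_pos hy] at hxy'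

theorem exists_coloring [Infinite X] :
    ∃ c : X → Fin 3, ∀ i, #{x | c x = i} = #X := by
  have h : #X = #(X × Fin 3) := by
    simpa using (mul_eq_left (aleph0_le_mk X) ((natCast_lt_aleph0 (n := 3)).le.trans (aleph0_le_mk X))
      (by norm_num)).symm
  obtain ⟨e⟩ := Cardinal.eq.1 h
  refine ⟨fun x => (e x).2, fun i => ?_⟩
  have hinj : Function.Injective fun x => e.symm (x, i) := fun x y hxy => by simpa using hxy
  refine mk_eq_of_subset ?_ (mk_range_eq _ hinj)
  rintro _ ⟨x, rfl⟩
  simp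

end FunctionClone

open FunctionClone in
theorem theorem3 {X : Type*} [Infinite X] (C : FunctionClone X)
    (hsymm : C.IsSymmetric) (hpre : C.IsPrecomplete) : C.ContainsPerms := by
  intro σ
  by_contra hσ
  obtain ⟨A, B, -, -, hAB, hA, hB⟩ := exists_disjoint_subsets (mk_univ (α := X))
  obtain ⟨α, hα, hαfix⟩ := exists_perm_notMem_fixing hsymm hσ (isMoiety_of_disjoint hAB hA hB)
  obtain ⟨c, hc⟩ := exists_coloring (X := X)
  have hp := fun i : Fin 3 => exists_mem_unary_injOn hsymm hpre hσ (D := {x | c x ≠ i}) hA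
    (by simpa [Set.compl_ofPred] using hc i)
  choose p hpC hpA hpinj using hp
  -- Two points have at most two colours, so they both avoid some colour `i` and `p i` tells them
  -- apart.
  have hinj : Function.Injective fun x i => p i x := by
    intro x y hxy
    obtain ⟨i, hx, hy⟩ : ∃ i : Fin 3, c x ≠ i ∧ c y ≠ i := by
      generalize c x = a
      generalize c y = b
      revert a b
      decide
    exact hpinj i hx hy (congrFun hxy i)
  obtain ⟨f, hf, hfh⟩ := exists_mem_ops_eqOn hsymm hpre hα hαfix (n := 3)
    fun t => σ (Function.invFun (fun x i => p i x) t)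
  have hmem := comp_unary_mem_unary hf hpC
  have heq : (fun x => f fun i => p i x) = σ := by
    funext x
    rw [hfh _ fun i => hpA i x]
    exact congrArg σ (Function.leftInverse_invFun hinj x)
  rw [heq] at hmem
  exact hσ hmem
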